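/- Let $\Gamma=(G,\sigma)$ be a signed graph, that is, a finite simple graph $G$ together with a sign function $\sigma:E(G)\to\{+1,-1\}$. Its adjacency matrix $A(\Gamma)$ has $(u,v)$-entry $\sigma(uv)$ if $uv\in E(G)$ and $0$ otherwise. The spectrum of $\Gamma$ is called symmetric if for each eigenvalue $\lambda$ of $A(\Gamma)$, $-\lambda$ is also an eigenvalue of $A(\Gamma)$ with the same multiplicity. A $2$-regular subgraph $C$ of $G$ is a (nonempty) union of vertex-disjoint cycles of $G$; $p(C)$ denotes the number of its cycles, $V(C)$ its vertex set, and $\sigma(C)=\prod_{e\in E(C)}\sigma(e)$ the product of the signs of its cycles. $C$ is odd if the sum of the lengths of its cycles, $|V(C)|$, is odd; let $\mathcal{C}_1$ be the set of odd $2$-regular subgraphs of $G$. For a finite graph $H$ with $n$ vertices, $M(H,x)=\sum_{i\ge 0}(-1)^i m_i(H)\,x^{n-2i}$ is its matching polynomial, where $m_i(H)$ is the number of sets of $i$ pairwise disjoint edges of $H$. Then $\Gamma$ has a symmetric spectrum if and only if $$\sum_{C\in\mathcal{C}_1}\sigma(C)\,(-2)^{p(C)}\,M(G-V(C),x)=0$$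 as a polynomial in $x$. -/

import Mathlib

open Polynomial

/-- A signed graph `(G, σ)` on the vertex set `V`: a simple graph together with a sign function
`σ : E(G) → {+1, -1}`. -/
structure SignedGraph (V : Type*) where
  /-- the underlying graph -/
  graph : SimpleGraph V
  /-- the signature -/
  sign : graph.edgeSet → ℤˣ

/-- The number `m_i(G)` of `i`-matchings of `G`. A Mathlib matching is a subgraph in which every
vertex has exactly one neighbour, so it is determined by its set of (independent) edges. -/
noncomputable def SimpleGraph.matchingCount {W : Type*} (G : SimpleGraph W) (i : ℕ) : ℕ :=
  Nat.card {M : G.Subgraph // M.IsMatching ∧ M.edgeSet.ncard = i}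

/-- The matching polynomial `M(G, x) = ∑ i, (-1)^i m_i(G) x^(n - 2i)` of a finite graph with `n`
vertices. A matching has at most `n / 2` edges, so the sum runs over all possible sizes. -/
noncomputable def SimpleGraph.matchingPolynomial {W : Type*} (G : SimpleGraph W) : ℤ[X] :=
  ∑ i ∈ Finset.range (Nat.card W / 2 + 1),
    C ((-1) ^ i * (G.matchingCount i : ℤ)) * X ^ (Nat.card W - 2 * i)

namespace SignedGraph

variable {V : Type*}

open Classical in
/-- The adjacency matrix: the entry at `(u, v)` is the sign of the edge `uv`, and `0` if `u` and
`v` are not adjacent. -/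
noncomputable def adjMatrix (Γ : SignedGraph V) : Matrix V V ℝ :=
  Matrix.of fun u v => if h : Γ.graph.Adj u v then ((Γ.sign ⟨s(u, v), h⟩ : ℤ) : ℝ) else 0

open Classical in
/-- The spectrum: the multiset of the eigenvalues of the (real symmetric) adjacency matrix, i.e.
of the roots of its characteristic polynomial, with their multiplicities. -/
noncomputable def spectrum [Fintype V] (Γ : SignedGraph V) : Multiset ℝ :=
  Γ.adjMatrix.charpoly.roots

open Classical in
/-- For every eigenvalue `μ`, also `-μ` is an eigenvalue, with the same multiplicity. -/
def HasSymmetricSpectrum [Fintype V] (Γ : SignedGraph V) : Prop :=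
  ∀ μ ∈ Γ.spectrum, -μ ∈ Γ.spectrum ∧ Γ.spectrum.count (-μ) = Γ.spectrum.count μ

/-- A 2-regular subgraph of the underlying graph, that is, a disjoint union of one or more cycles:
it is nonempty and each of its vertices has exactly two neighbours in it. -/
def IsTwoRegular (Γ : SignedGraph V) (H : Γ.graph.Subgraph) : Prop :=
  H.verts.Nonempty ∧ ∀ v ∈ H.verts, (H.neighborSet v).ncard = 2

/-- An odd 2-regular subgraph: the lengths of its cycles add up to an odd number. As the cycles
are disjoint, the lengths add up to the number of vertices. -/
def IsOddTwoRegular (Γ : SignedGraph V) (H : Γ.graph.Subgraph) : Prop :=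
  Γ.IsTwoRegular H ∧ Odd H.verts.ncard

open Classical in
/-- The sign `σ(H)`: the product of the signs of all edges of `H`. For a 2-regular `H` this is the
product of the signs of its cycles. -/
noncomputable def subgraphSign [Fintype V] (Γ : SignedGraph V) (H : Γ.graph.Subgraph) : ℤˣ :=
  ∏ e : H.edgeSet, Γ.sign ⟨e, H.edgeSet_subset e.2⟩

/-- The number of connected components of `H`; for a 2-regular `H` these are its cycles. -/
noncomputable def numCycles (Γ : SignedGraph V) (H : Γ.graph.Subgraph) : ℕ :=
  Nat.card H.coe.ConnectedComponent

open Classical in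
/-- The odd part of the characteristic polynomial: the sum of `σ(H) (-2)^p(H) M(G - V(H), x)`
over all odd 2-regular subgraphs `H` of `G`. -/
noncomputable def oddPart [Fintype V] (Γ : SignedGraph V) : ℤ[X] :=
  ∑ H : Γ.graph.Subgraph with Γ.IsOddTwoRegular H,
    C ((Γ.subgraphSign H : ℤ) * (-2) ^ Γ.numCycles H) *
      (Γ.graph.induce (H.vertsᶜ : Set V)).matchingPolynomial

end SignedGraph

/-! Expand `det (xI - A)` over permutations. Only permutations that move vertices along edges
contribute. The cycles of length at least three of such a permutation trace a (possibly empty)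
subgraph `H` with all degrees two, and what remains is an involution, that is, a matching of `G -
V(H)`. Each `H` is traced by `2 ^ p(H)` choices of directions, and each choice contributes `(-1) ^
p(H) * σ(H)`. Hence the characteristic polynomial is the sum of `σ(H) (-2)^p(H) M(G - V(H), x)` over
all such `H` (`charpoly_intAdjMatrix`).

A matching polynomial on `k` vertices has only exponents of the parity of `k`, so the term of `H`
has the parity of `n - |V(H)|`. Thus `oddPart` and `evenPart` are the parts of the characteristic
polynomial of parity opposite and equal to that of `n`. A monic real polynomial `φ` of degree `n`
that splits has a symmetric root multiset iff `φ(-x) = (-1)^n φ(x)`, that is, iff its part of the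
wrong parity vanishes.

The delicate point is the count `2 ^ p(H)`: a 2-regular graph is given only by its degrees, so
consistent directions on its cycles must be constructed (`exists_isOrientation`). -/

/-- In an infinite dihedral action generated by fixed-point free involutions `r` and `s`, no power
of the translation `r * s` agrees with the reflection `s` at a point. -/
theorem Equiv.Perm.not_sameCycle_of_involutive {α : Type*} {r s : Equiv.Perm α}
    (hr : ∀ d, r (r d) = d) (hs : ∀ d, s (s d) = d) (hr' : ∀ d, r d ≠ d) (hs' : ∀ d, s d ≠ d)
    (d : α) : ¬ (r * s).SameCycle d (s d) := by
  have hrr : r * r = 1 := Equiv.ext hr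
  have hss : s * s = 1 := Equiv.ext hs
  have hr1 : r⁻¹ = r := inv_eq_of_mul_eq_one_left hrr
  have hs1 : s⁻¹ = s := inv_eq_of_mul_eq_one_left hss
  have hconj : s * (r * s) * s⁻¹ = (r * s)⁻¹ := by
    rw [mul_inv_rev, hr1, hs1, mul_assoc, mul_assoc, hss, mul_one]
  have hz : ∀ j : ℤ, ∀ x, s (((r * s) ^ j) x) = ((r * s) ^ (-j)) (s x) := by
    intro j x
    have h1 : s * (r * s) ^ j * s⁻¹ = (r * s) ^ (-j) := by
      rw [← conj_zpow, hconj, inv_zpow, zpow_neg]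
    rw [← h1]
    simp
  rintro ⟨k, hk⟩
  -- If `(r * s) ^ k` sends `d` to `s d`, then halving `k` produces a fixed point: of `s` for `k =
  -- 2j`, of `r` for `k = 2j + 1`.
  obtain ⟨j, rfl | rfl⟩ := Int.even_or_odd' k
  · apply hs' (((r * s) ^ j) d)
    rw [hz, ← hk, ← Equiv.Perm.mul_apply, ← zpow_add]
    congr 2
    ring
  · apply hr' (s (((r * s) ^ j) d))
    have h1 : r (s (((r * s) ^ j) d)) = ((r * s) ^ (1 + j)) d := by
      rw [zpow_add, zpow_one]; rfl
    rw [h1, hz, ← hk, ← Equiv.Perm.mul_apply, ← zpow_add]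
    congr 2
    ring

/-! ### Orientations of 2-regular graphs -/

namespace SimpleGraph

variable {W : Type*} {K : SimpleGraph W}

/-- A permutation that moves every vertex along an edge and has no 2-cycles: on a 2-regular graph,
a choice of a direction of travel on each of its cycles. -/
def IsOrientation (K : SimpleGraph W) (ρ : Equiv.Perm W) : Prop :=
  ∀ v, K.Adj v (ρ v) ∧ ρ (ρ v) ≠ v

theorem eq_of_adj_of_ne {v a b c : W} (hK : (K.neighborSet v).ncard = 2) (ha : K.Adj v a)
    (hb : K.Adj v b) (hc : K.Adj v c) (hba : b ≠ a) (hca : c ≠ a) : b = c := by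
  obtain ⟨x, y, hxy, h⟩ := Set.ncard_eq_two.1 hK
  have h' : ∀ w, K.Adj v w ↔ w = x ∨ w = y := fun w => by
    rw [← mem_neighborSet, h]; simp
  rw [h'] at ha hb hc
  grind

/-- The flip `r` exchanges the two darts leaving a vertex. Composed with dart reversal it becomes
the walk along a cycle: arrive at a vertex and leave by the other edge. -/
theorem exists_dart_flip (hK : ∀ v, (K.neighborSet v).ncard = 2) :
    ∃ r : Equiv.Perm K.Dart, (∀ d, (r d).fst = d.fst) ∧ (∀ d, r d ≠ d) ∧ (∀ d, r (r d) = d) ∧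
      ∀ d e : K.Dart, d.fst = e.fst → e = d ∨ e = r d := by
  have key : ∀ d : K.Dart, ∃ w, K.Adj d.fst w ∧ w ≠ d.snd := by
    intro d
    obtain ⟨x, y, hxy, h⟩ := Set.ncard_eq_two.1 (hK d.fst)
    have h' : ∀ w, K.Adj d.fst w ↔ w = x ∨ w = y := fun w => by
      rw [← mem_neighborSet, h]; simp
    by_cases hx : d.snd = x
    · exact ⟨y, (h' y).2 (Or.inr rfl), by rw [hx]; exact hxy.symm⟩
    · exact ⟨x, (h' x).2 (Or.inl rfl), Ne.symm hx⟩
  choose f hf hf' using key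
  let g : K.Dart → K.Dart := fun d => ⟨(d.fst, f d), hf d⟩
  have hg : ∀ d, g (g d) = d := by
    intro d
    refine Dart.ext _ _ (Prod.ext rfl ?_)
    exact eq_of_adj_of_ne (hK d.fst) (hf d) (hf (g d)) d.adj (hf' (g d)) (hf' d).symm
  refine ⟨⟨g, g, hg, hg⟩, fun d => rfl, fun d h => hf' d ?_, hg, ?_⟩
  · exact congrArg (fun e : K.Dart => e.snd) h
  · intro d e hde
    by_cases h : e.snd = d.snd
    · exact Or.inl (Dart.ext _ _ (Prod.ext hde.symm h))
    · refine Or.inr (Dart.ext _ _ (Prod.ext hde.symm ?_))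
      exact eq_of_adj_of_ne (hK d.fst) d.adj (by rw [hde]; exact e.adj) (hf d) h (hf' d)

/-- Let `N` be the walk on darts, and let `S` hold for the darts in the `N`-orbit of the dart
prescribed on their component. By the dihedral lemma an orbit never contains both a dart and its
reversal. So `S` selects at most one dart out of each vertex, and propagation along edges gives at
least one. Following the selected darts is the orientation. -/
theorem exists_isOrientation [Finite W] (hK : ∀ v, (K.neighborSet v).ncard = 2)
    (f : ∀ c : K.ConnectedComponent, K.neighborSet c.out) :
    ∃ ρ, K.IsOrientation ρ ∧ ∀ c : K.ConnectedComponent, ρ c.out = f c := by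
  obtain ⟨r, hr1, hr2, hr3, hr4⟩ := exists_dart_flip hK
  let s : Equiv.Perm K.Dart := ⟨Dart.symm, Dart.symm, Dart.symm_symm, Dart.symm_symm⟩
  have hs : ∀ d, s d = d.symm := fun _ => rfl
  let N := r * s
  have hN : ∀ d, N d = r d.symm := fun _ => rfl
  have hns : ∀ d, ¬ N.SameCycle d d.symm :=
    Equiv.Perm.not_sameCycle_of_involutive hr3 Dart.symm_symm hr2 Dart.symm_ne
  let D : K.ConnectedComponent → K.Dart := fun c => ⟨(c.out, f c), (f c).2⟩
  let S : K.Dart → Prop := fun d => N.SameCycle (D (K.connectedComponentMk d.fst)) d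
  have hcomp : ∀ d : K.Dart, K.connectedComponentMk d.snd = K.connectedComponentMk d.fst :=
    fun d => ConnectedComponent.sound d.adj.symm.reachable
  have hNfst : ∀ d, (N d).fst = d.snd := fun d => by rw [hN, hr1]; rfl
  have hSN : ∀ d, S (N d) ↔ S d := by
    intro d
    simp only [S, hNfst, hcomp, Equiv.Perm.sameCycle_apply_right]
  have hSs : ∀ d, S d → ¬ S d.symm := by
    intro d h h'
    have h'' : N.SameCycle (D (K.connectedComponentMk d.fst)) d.symm := by
      simp only [S, Dart.symm] at h'
      rw [← hcomp d]
      exact h'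
    exact hns d (h.symm.trans h'')
  have hSr : ∀ d, S (r d) ↔ S d.symm := by
    intro d
    rw [← hSN d.symm, hN, Dart.symm_symm]
  have hex : ∀ v, ∀ d : K.Dart, d.fst = v → S d ∨ S (r d) := by
    have step : ∀ u v, K.Adj u v → (∀ d : K.Dart, d.fst = u → S d ∨ S (r d)) →
        ∀ d : K.Dart, d.fst = v → S d ∨ S (r d) := by
      intro u v huv hu d hd
      rcases hu ⟨(u, v), huv⟩ rfl with h | h
      · have h1 := (hSN _).2 h
        rcases hr4 d (N ⟨(u, v), huv⟩) (by rw [hNfst, hd]) with h2 | h2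
        · exact Or.inl (h2 ▸ h1)
        · exact Or.inr (h2 ▸ h1)
      · have h1 := (hSr _).1 h
        rcases hr4 d (Dart.symm ⟨(u, v), huv⟩) hd with h2 | h2
        · exact Or.inl (h2 ▸ h1)
        · exact Or.inr (h2 ▸ h1)
    intro v
    have hreach : K.Reachable (K.connectedComponentMk v).out v :=
      ConnectedComponent.exact (Quot.out_eq (K.connectedComponentMk v))
    have hbase : ∀ d : K.Dart, d.fst = (K.connectedComponentMk v).out → S d ∨ S (r d) := by
      intro d hd
      have hSD : S (D (K.connectedComponentMk v)) := by
        have : K.connectedComponentMk (D (K.connectedComponentMk v)).fst =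
            K.connectedComponentMk v := Quot.out_eq (K.connectedComponentMk v)
        simp only [S, this]
        exact Equiv.Perm.SameCycle.refl _ _
      rcases hr4 d (D (K.connectedComponentMk v)) hd with h2 | h2
      · exact Or.inl (h2 ▸ hSD)
      · exact Or.inr (h2 ▸ hSD)
    obtain ⟨p⟩ := hreach
    generalize (K.connectedComponentMk v).out = u at p hbase
    induction p with
    | nil => exact hbase
    | cons h p ih => exact ih (step _ _ h hbase)
  have huniq : ∀ d e : K.Dart, S d → S e → d.fst = e.fst → e = d := by
    intro d e hd he hde
    rcases hr4 d e hde with h | h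
    · exact h
    · exact absurd ((hSr d).1 (h ▸ he)) (hSs d hd)
  have hex' : ∀ v, ∃ d : K.Dart, d.fst = v ∧ S d := by
    intro v
    obtain ⟨x, hx⟩ : (K.neighborSet v).Nonempty :=
      Set.nonempty_of_ncard_ne_zero (by rw [hK]; norm_num)
    rcases hex v ⟨(v, x), hx⟩ rfl with h | h
    · exact ⟨_, rfl, h⟩
    · exact ⟨_, hr1 _, h⟩
  choose δ hδ hδS using hex'
  have hadj : ∀ v, K.Adj v (δ v).snd := fun v => by
    have := (δ v).adj
    rwa [hδ] at this
  have hback : ∀ v, (δ (δ v).snd).snd ≠ v := by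
    intro v h
    apply hSs _ (hδS v)
    have : (δ v).symm = δ (δ v).snd := by
      refine Dart.ext _ _ (Prod.ext (hδ _).symm ?_)
      exact (hδ v).trans h.symm
    rw [this]
    exact hδS _
  -- If two selected darts entered the same vertex from different vertices, the reversal of one
  -- would be the continuation of the other, hence selected as well.
  have hinj : Function.Injective fun v => (δ v).snd := by
    intro v v' h
    by_contra hne
    simp only at h
    apply hSs _ (hδS v')
    have h1 : (δ v').symm = N (δ v) := by
      rcases hr4 (δ v').symm (N (δ v)) (by rw [hNfst]; exact h.symm) with h2 | h2
      · exact h2.symm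
      · exfalso
        rw [hN] at h2
        have h3 := congrArg (fun d : K.Dart => d.snd) (r.injective h2)
        exact hne ((hδ v).symm.trans (h3.trans (hδ v')))
    rw [h1, hSN]
    exact hδS v
  refine ⟨Equiv.ofBijective _ (Finite.injective_iff_bijective.1 hinj),
    fun v => ⟨hadj v, hback v⟩, fun c => ?_⟩
  have hSD : S (D c) := by
    have : K.connectedComponentMk (D c).fst = c := Quot.out_eq c
    simp only [S, this]
    exact Equiv.Perm.SameCycle.refl _ _
  have := huniq _ _ hSD (hδS c.out) (hδ c.out).symm
  change (δ c.out).snd = f c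
  rw [this]

namespace IsOrientation

/-- Since `ρ` has no 2-cycles, `ρ v` and `ρ⁻¹ v` are distinct, so they exhaust the two neighbours of
`v`. -/
theorem adj_iff {ρ : Equiv.Perm W} (hK : ∀ v, (K.neighborSet v).ncard = 2)
    (h : K.IsOrientation ρ) {v w : W} : K.Adj v w ↔ w = ρ v ∨ v = ρ w := by
  constructor
  · intro hvw
    by_contra! hne
    have h1 : K.Adj v (ρ.symm v) := by simpa using (h (ρ.symm v)).1.symm
    have h2 : ρ.symm v ≠ ρ v := fun h' => (h (ρ.symm v)).2 (by
      rw [Equiv.apply_symm_apply]; exact h'.symm)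
    have := eq_of_adj_of_ne (hK v) (h v).1 hvw h1 hne.1 h2
    exact hne.2 (by simp [this])
  · rintro (rfl | rfl)
    · exact (h v).1
    · exact (h w).1.symm

/-- Agreement of two orientations at one end of an edge forces agreement at the other, so one vertex
per component decides everything. -/
theorem eq_of_forall_out {ρ ρ' : Equiv.Perm W} (hK : ∀ v, (K.neighborSet v).ncard = 2)
    (h : K.IsOrientation ρ) (h' : K.IsOrientation ρ')
    (hout : ∀ c : K.ConnectedComponent, ρ c.out = ρ' c.out) : ρ = ρ' := by
  have step : ∀ u v, K.Adj u v → ρ u = ρ' u → ρ v = ρ' v := by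
    intro u v huv hu
    rcases (h.adj_iff hK).1 huv with rfl | rfl
    · exact eq_of_adj_of_ne (hK (ρ u)) (h u).1.symm (h (ρ u)).1 (hu ▸ (h' (ρ' u)).1) (h u).2
        (hu ▸ (h' u).2)
    · rcases (h'.adj_iff hK).1 huv with h2 | h2
      · exact absurd (by rw [hu, ← h2]) (h v).2
      · exact h2
  ext v
  have hreach : K.Reachable (K.connectedComponentMk v).out v :=
    ConnectedComponent.exact (Quot.out_eq (K.connectedComponentMk v))
  have hbase := hout (K.connectedComponentMk v)
  obtain ⟨p⟩ := hreach
  generalize (K.connectedComponentMk v).out = u at p hbase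
  induction p with
  | nil => exact hbase
  | cons h p ih => exact ih (step _ _ h hbase)

end IsOrientation

theorem card_isOrientation [Finite W] (hK : ∀ v, (K.neighborSet v).ncard = 2) :
    Nat.card {ρ // K.IsOrientation ρ} = 2 ^ Nat.card K.ConnectedComponent := by
  classical
  have := Fintype.ofFinite W
  have := Fintype.ofFinite K.ConnectedComponent
  let F : {ρ // K.IsOrientation ρ} → ∀ c : K.ConnectedComponent, K.neighborSet c.out :=
    fun ρ c => ⟨ρ.1 c.out, (ρ.2 c.out).1⟩
  have hF : Function.Bijective F := by
    constructor
    · intro ρ ρ' h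
      refine Subtype.ext (ρ.2.eq_of_forall_out hK ρ'.2 fun c => ?_)
      exact congrArg Subtype.val (congrFun h c)
    · intro f
      obtain ⟨ρ, h1, h2⟩ := exists_isOrientation hK f
      exact ⟨⟨ρ, h1⟩, funext fun c => Subtype.ext (h2 c)⟩
  rw [Nat.card_congr (Equiv.ofBijective F hF), Nat.card_pi]
  simp_rw [Nat.card_coe_set_eq, hK]
  simp

theorem IsOrientation.reachable_iff [Finite W] {ρ : Equiv.Perm W}
    (hK : ∀ v, (K.neighborSet v).ncard = 2) (h : K.IsOrientation ρ) {v w : W} :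
    K.Reachable v w ↔ ρ.SameCycle v w := by
  constructor
  · rintro ⟨p⟩
    induction p with
    | nil => exact Equiv.Perm.SameCycle.refl _ _
    | cons huv p ih =>
      refine Equiv.Perm.SameCycle.trans ?_ ih
      rcases (h.adj_iff hK).1 huv with rfl | rfl
      · exact Equiv.Perm.sameCycle_apply_right.2 (Equiv.Perm.SameCycle.refl _ _)
      · exact Equiv.Perm.sameCycle_apply_left.2 (Equiv.Perm.SameCycle.refl _ _)
  · intro hs
    obtain ⟨n, -, rfl⟩ := hs.exists_pow_eq'
    clear hs
    induction n with
    | zero => simp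
    | succ n ih =>
      rw [pow_succ', Equiv.Perm.mul_apply]
      exact ih.trans (h _).1.reachable

/-- The orbits of `ρ` are the connected components, and none is a single point, so each one is a
genuine cycle. -/
theorem IsOrientation.card_cycleType [Fintype W] [DecidableEq W] {ρ : Equiv.Perm W}
    (hK : ∀ v, (K.neighborSet v).ncard = 2) (h : K.IsOrientation ρ) :
    ρ.cycleType.card = Nat.card K.ConnectedComponent := by
  have hfix : ∀ v, ρ v ≠ v := fun v hv => (h v).1.ne hv.symm
  rw [Equiv.Perm.cycleType_def, Multiset.card_map, Finset.card_val, ← Fintype.card_coe,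
    ← Nat.card_eq_fintype_card]
  let F : K.ConnectedComponent → ρ.cycleFactorsFinset :=
    Quot.lift (fun v => ⟨ρ.cycleOf v, Equiv.Perm.cycleOf_mem_cycleFactorsFinset_iff.2
      (Equiv.Perm.mem_support.2 (hfix v))⟩) fun v w hvw =>
        Subtype.ext ((h.reachable_iff hK).1 hvw).cycleOf_eq
  refine (Nat.card_congr (Equiv.ofBijective F ⟨?_, ?_⟩)).symm
  · rintro ⟨v⟩ ⟨w⟩ hvw
    refine ConnectedComponent.sound ((h.reachable_iff hK).2 ?_)
    exact (Equiv.Perm.sameCycle_iff_cycleOf_eq_of_mem_support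
      (Equiv.Perm.mem_support.2 (hfix v)) (Equiv.Perm.mem_support.2 (hfix w))).2
      (congrArg Subtype.val hvw)
  · rintro ⟨c, hc⟩
    obtain ⟨hc1, hc2⟩ := Equiv.Perm.mem_cycleFactorsFinset_iff.1 hc
    obtain ⟨v, hv, -⟩ := hc1
    refine ⟨K.connectedComponentMk v, Subtype.ext ?_⟩
    exact (Equiv.Perm.cycle_is_cycleOf (Equiv.Perm.mem_support.2 hv) hc).symm

theorem IsOrientation.sign_eq [Fintype W] [DecidableEq W] {ρ : Equiv.Perm W}
    (hK : ∀ v, (K.neighborSet v).ncard = 2) (h : K.IsOrientation ρ) :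
    Equiv.Perm.sign ρ = (-1) ^ Fintype.card W * (-1) ^ Nat.card K.ConnectedComponent := by
  have hsupp : ρ.support = Finset.univ := by
    ext v
    simpa using fun hv => (h v).1.ne (Eq.symm hv)
  rw [Equiv.Perm.sign_of_cycleType, Equiv.Perm.sum_cycleType, hsupp, h.card_cycleType hK, pow_add,
    Finset.card_univ]

end SimpleGraph

/-! ### Matchings as involutions, and the matching polynomial -/

namespace SimpleGraph

variable {W : Type*} {K : SimpleGraph W}

/-- An involution that moves vertices only along edges; its 2-cycles form a matching. -/
def IsMatchingPerm (K : SimpleGraph W) (τ : Equiv.Perm W) : Prop :=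
  ∀ v, τ (τ v) = v ∧ (τ v ≠ v → K.Adj v (τ v))

/-- The edges joining each vertex moved by a permutation to its image, if the permutation swaps
the two vertices. -/
def swapSubgraph (K : SimpleGraph W) (τ : Equiv.Perm W) : K.Subgraph where
  verts := {v | τ v ≠ v}
  Adj u v := K.Adj u v ∧ τ u = v ∧ τ v = u
  adj_sub h := h.1
  edge_vert h := fun h' => h.1.ne (h'.symm.trans h.2.1)
  symm := ⟨fun _ _ h => ⟨h.1.symm, h.2.2, h.2.1⟩⟩

theorem IsMatchingPerm.isMatching {τ : Equiv.Perm W} (h : K.IsMatchingPerm τ) :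
    (K.swapSubgraph τ).IsMatching :=
  fun v hv => ⟨τ v, ⟨(h v).2 hv, rfl, (h v).1⟩, fun _ hw => hw.2.1.symm⟩

theorem IsMatchingPerm.ext_of_swapSubgraph {τ τ' : Equiv.Perm W} (h : K.IsMatchingPerm τ)
    (h' : K.swapSubgraph τ = K.swapSubgraph τ') : τ = τ' := by
  ext v
  by_cases hv : τ v = v
  · have : v ∉ (K.swapSubgraph τ').verts := by
      rw [← h']
      exact not_not.2 hv
    rw [hv]
    exact (not_not.1 this).symm
  · have : (K.swapSubgraph τ).Adj v (τ v) := ⟨(h v).2 hv, rfl, (h v).1⟩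
    rw [h'] at this
    exact this.2.1.symm

theorem Subgraph.IsMatching.exists_isMatchingPerm {M : K.Subgraph} (hM : M.IsMatching) :
    ∃ τ, K.IsMatchingPerm τ ∧ K.swapSubgraph τ = M := by
  classical
  choose f hf hf' using hM
  let g : W → W := fun v => if h : v ∈ M.verts then f h else v
  have hg : ∀ {v}, v ∈ M.verts → M.Adj v (g v) := by
    intro v h
    simp only [g, dif_pos h]
    exact hf h
  have huniq : ∀ {v w}, M.Adj v w → w = g v := by
    intro v w h
    simp only [g, dif_pos h.fst_mem]
    exact hf' h.fst_mem _ h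
  have hgn : ∀ {v}, v ∉ M.verts → g v = v := fun h => dif_neg h
  have hgg : ∀ v, g (g v) = v := by
    intro v
    by_cases h : v ∈ M.verts
    · exact (huniq (hg h).symm).symm
    · rw [hgn h, hgn h]
  have hne : ∀ {v}, g v ≠ v ↔ v ∈ M.verts :=
    ⟨fun h => by_contra fun h' => h (hgn h'), fun h => (hg h).adj_sub.ne'⟩
  refine ⟨⟨g, g, hgg, hgg⟩, fun v => ⟨hgg v, fun h => (hg (hne.1 h)).adj_sub⟩, ?_⟩
  refine Subgraph.ext (Set.ext fun v => hne) ?_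
  ext u v
  constructor
  · rintro ⟨h1, h2, -⟩
    have h2 : g u = v := h2
    have hu : u ∈ M.verts := hne.1 (by rw [h2]; exact h1.ne')
    exact h2 ▸ hg hu
  · exact fun h => ⟨h.adj_sub, (huniq h).symm, (huniq h.symm).symm⟩

/-- The handshake lemma for the spanning subgraph, whose degrees are one on the matched vertices and
zero elsewhere. -/
theorem Subgraph.IsMatching.two_mul_ncard_edgeSet [Finite W] {M : K.Subgraph} (hM : M.IsMatching) :
    2 * M.edgeSet.ncard = M.verts.ncard := by
  classical
  have := Fintype.ofFinite W
  have h := M.spanningCoe.sum_degrees_eq_twice_card_edges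
  have hd : ∀ v, M.spanningCoe.degree v = if v ∈ M.verts then 1 else 0 := by
    intro v
    rw [Subgraph.degree_spanningCoe]
    split_ifs with hv
    · exact (Subgraph.isMatching_iff_forall_degree.1 hM) v hv
    · exact Fintype.card_eq_zero_iff.2 ⟨fun w => hv (show M.Adj v w from w.2).fst_mem⟩
  simp_rw [hd] at h
  rw [Finset.sum_boole, Nat.cast_id] at h
  have hv : M.verts.ncard = (Finset.univ.filter fun v => v ∈ M.verts).card := by
    rw [Set.ncard_eq_toFinset_card']
    congr 1
    ext v
    simp
  rw [hv, h, ← Subgraph.edgeSet_spanningCoe, Set.ncard_eq_toFinset_card']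
  rfl

open Classical in
theorem matchingPolynomial_eq_sum_isMatching [Fintype W] (K : SimpleGraph W) :
    K.matchingPolynomial = ∑ M : K.Subgraph with M.IsMatching,
      C ((-1) ^ M.edgeSet.ncard) * X ^ (Nat.card W - M.verts.ncard) := by
  have hmaps : ∀ M ∈ Finset.univ.filter fun M : K.Subgraph => M.IsMatching,
      M.edgeSet.ncard ∈ Finset.range (Nat.card W / 2 + 1) := by
    intro M hM
    have h1 := (Finset.mem_filter.1 hM).2.two_mul_ncard_edgeSet
    have h2 := Set.ncard_le_card M.verts
    rw [Finset.mem_range]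
    omega
  rw [← Finset.sum_fiberwise_of_maps_to hmaps, matchingPolynomial]
  refine Finset.sum_congr rfl fun i _ => ?_
  rw [Finset.filter_filter, Finset.sum_congr rfl (g := fun _ => C ((-1) ^ i) *
    X ^ (Nat.card W - 2 * i)), Finset.sum_const, matchingCount, Nat.card_eq_fintype_card,
    Fintype.card_subtype, nsmul_eq_mul, C_mul, mul_comm (C _) (C _), mul_assoc]
  · simp
  · intro M hM
    obtain ⟨h1, rfl⟩ := (Finset.mem_filter.1 hM).2
    rw [h1.two_mul_ncard_edgeSet]

open Classical in
-- Each fixed point contributes `X`. Each 2-cycle contributes `w u v * w v u = 1` to the product and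
-- `-1` to the sign.
theorem IsMatchingPerm.sign_mul_prod [Fintype W] {τ : Equiv.Perm W} (h : K.IsMatchingPerm τ)
    {w : W → W → ℤ[X]} (hX : ∀ v, w v v = X) (hw : ∀ u v, K.Adj u v → w u v * w v u = 1) :
    ((Equiv.Perm.sign τ : ℤ) : ℤ[X]) * ∏ v, w v (τ v) =
      C ((-1) ^ (K.swapSubgraph τ).edgeSet.ncard) *
        X ^ (Nat.card W - (K.swapSubgraph τ).verts.ncard) := by
  have hmoved : (K.swapSubgraph τ).verts.ncard = (Finset.univ.filter fun v => τ v ≠ v).card := by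
    rw [Set.ncard_eq_toFinset_card']
    congr 1
    ext v
    rw [Set.mem_toFinset, Finset.mem_filter_univ]
    rfl
  have hsplit := Finset.card_filter_add_card_filter_not (s := (Finset.univ : Finset W))
    (fun v => τ v ≠ v)
  have hsign : Equiv.Perm.sign τ = (-1) ^ (K.swapSubgraph τ).edgeSet.ncard := by
    rw [Equiv.Perm.sign_of_pow_two_eq_one (by ext v; simp [pow_two, (h v).1])]
    congr 1
    have h1 := h.isMatching.two_mul_ncard_edgeSet
    have h2 : Fintype.card (Function.fixedPoints τ) =
        (Finset.univ.filter fun v => ¬ τ v ≠ v).card := by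
      rw [← Set.toFinset_card]
      congr 1
      ext v
      rw [Set.mem_toFinset, Finset.mem_filter_univ, not_not]
      rfl
    rw [Finset.card_univ] at hsplit
    omega
  have hprod : ∏ v, w v (τ v) = X ^ (Nat.card W - (K.swapSubgraph τ).verts.ncard) := by
    rw [← Finset.prod_filter_mul_prod_filter_not _ (fun v => τ v ≠ v),
      Finset.prod_involution (fun v _ => τ v), one_mul, Finset.prod_congr rfl (g := fun _ => X),
      Finset.prod_const]
    · congr 1
      rw [Finset.card_univ] at hsplit
      rw [Nat.card_eq_fintype_card]
      omega
    · intro v hv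
      rw [not_not.1 (Finset.mem_filter.1 hv).2, hX]
    · intro v hv
      rw [(h v).1]
      exact hw _ _ ((h v).2 (Finset.mem_filter.1 hv).2)
    · exact fun v hv _ => (Finset.mem_filter.1 hv).2
    · exact fun v hv => Finset.mem_filter.2
        ⟨Finset.mem_univ _, τ.injective.ne (Finset.mem_filter.1 hv).2⟩
    · exact fun v _ => (h v).1
  rw [hprod, hsign]
  simp

open Classical in
theorem sum_isMatchingPerm [Fintype W] (K : SimpleGraph W) {w : W → W → ℤ[X]}
    (hX : ∀ v, w v v = X) (hw : ∀ u v, K.Adj u v → w u v * w v u = 1) :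
    ∑ τ : Equiv.Perm W with K.IsMatchingPerm τ,
      ((Equiv.Perm.sign τ : ℤ) : ℤ[X]) * ∏ v, w v (τ v) = K.matchingPolynomial := by
  rw [matchingPolynomial_eq_sum_isMatching]
  refine Finset.sum_bij (fun τ _ => K.swapSubgraph τ) ?_ ?_ ?_ ?_
  · intro τ hτ
    exact Finset.mem_filter.2 ⟨Finset.mem_univ _, (Finset.mem_filter.1 hτ).2.isMatching⟩
  · intro τ hτ τ' _ hττ'
    exact (Finset.mem_filter.1 hτ).2.ext_of_swapSubgraph hττ'
  · intro M hM
    obtain ⟨τ, h1, h2⟩ := (Finset.mem_filter.1 hM).2.exists_isMatchingPerm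
    exact ⟨τ, Finset.mem_filter.2 ⟨Finset.mem_univ _, h1⟩, h2⟩
  · intro τ hτ
    exact (Finset.mem_filter.1 hτ).2.sign_mul_prod hX hw

end SimpleGraph

/-! ### Splitting a permutation into long cycles and an involution -/

namespace SimpleGraph

variable {V : Type*} {G : SimpleGraph V}

/-- A permutation that moves vertices only along edges. -/
def IsEdgePerm (G : SimpleGraph V) (π : Equiv.Perm V) : Prop :=
  ∀ v, π v ≠ v → G.Adj v (π v)

/-- The subgraph traced by the cycles of length at least three of a permutation. -/
def cycleSubgraph (G : SimpleGraph V) (π : Equiv.Perm V) : G.Subgraph where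
  verts := {v | π (π v) ≠ v}
  Adj u v := G.Adj u v ∧ π (π u) ≠ u ∧ (v = π u ∨ u = π v)
  adj_sub h := h.1
  edge_vert h := h.2.1
  symm := ⟨by
    rintro u v ⟨h1, h2, rfl | rfl⟩
    · exact ⟨h1.symm, π.injective.ne h2, Or.inr rfl⟩
    · exact ⟨h1.symm, fun h => h2 (congrArg π h), Or.inl rfl⟩⟩

theorem IsEdgePerm.cycleSubgraph_adj {π : Equiv.Perm V} (h : G.IsEdgePerm π) {v : V}
    (hv : v ∈ (G.cycleSubgraph π).verts) : (G.cycleSubgraph π).Adj v (π v) :=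
  ⟨h v fun h' => hv (by rw [h', h']), hv, Or.inl rfl⟩

theorem IsEdgePerm.ncard_neighborSet {π : Equiv.Perm V} (h : G.IsEdgePerm π) {v : V}
    (hv : v ∈ (G.cycleSubgraph π).verts) : ((G.cycleSubgraph π).neighborSet v).ncard = 2 := by
  have hv' : π (π v) ≠ v := hv
  have hne : π v ≠ π.symm v := fun h' => hv' (by rw [h', Equiv.apply_symm_apply])
  rw [← Set.ncard_pair hne]
  congr 1
  ext w
  have hmem : w ∈ (G.cycleSubgraph π).neighborSet v ↔
      G.Adj v w ∧ π (π v) ≠ v ∧ (w = π v ∨ v = π w) := Iff.rfl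
  rw [hmem, Set.mem_insert_iff, Set.mem_singleton_iff, Equiv.eq_symm_apply, eq_comm (a := π w)]
  refine ⟨fun h => h.2.2, fun h' => ⟨?_, hv', h'⟩⟩
  rcases h' with rfl | rfl
  · exact h v fun h' => hv' (by rw [h', h'])
  · refine (h w fun h' => hv' ?_).symm
    rw [h', h', h']

/-- Once the traced edges lie in `H`, equality is automatic: at each vertex both neighbour sets have
two elements. The criterion can be checked separately on `H.verts` and its complement. -/
theorem IsEdgePerm.cycleSubgraph_eq_iff {π : Equiv.Perm V} (h : G.IsEdgePerm π) {H : G.Subgraph}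
    (hH : ∀ v ∈ H.verts, (H.neighborSet v).ncard = 2) :
    G.cycleSubgraph π = H ↔
      (∀ v, v ∈ H.verts ↔ π (π v) ≠ v) ∧ ∀ v ∈ H.verts, H.Adj v (π v) := by
  constructor
  · rintro rfl
    exact ⟨fun v => Iff.rfl, fun v hv => h.cycleSubgraph_adj hv⟩
  · rintro ⟨h1, h2⟩
    have hle : ∀ u v, (G.cycleSubgraph π).Adj u v → H.Adj u v := by
      rintro u v ⟨-, h3, rfl | rfl⟩
      · exact h2 u ((h1 u).2 h3)
      · exact (h2 v ((h1 v).2 fun h => h3 (congrArg π h))).symm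
    refine Subgraph.ext (Set.ext fun v => (h1 v).symm) ?_
    ext u v
    refine ⟨hle u v, fun huv => ?_⟩
    have hu : u ∈ (G.cycleSubgraph π).verts := (h1 u).1 huv.fst_mem
    have := Set.eq_of_subset_of_ncard_le (s := (G.cycleSubgraph π).neighborSet u)
      (t := H.neighborSet u) (hle u)
      (by rw [hH u huv.fst_mem]; exact (h.ncard_neighborSet hu).ge)
      (Set.finite_of_ncard_ne_zero (by rw [hH u huv.fst_mem]; norm_num))
    exact this.symm.subset huv

theorem Subgraph.ncard_neighborSet_coe {H : G.Subgraph}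
    (hH : ∀ v ∈ H.verts, (H.neighborSet v).ncard = 2) (v : H.verts) :
    (H.coe.neighborSet v).ncard = 2 := by
  rw [← hH v v.2, ← Set.ncard_image_of_injective _ Subtype.val_injective]
  congr 1
  ext w
  constructor
  · rintro ⟨w, hw, rfl⟩
    exact hw
  · exact fun hw => ⟨⟨w, Subgraph.Adj.snd_mem hw⟩, hw, rfl⟩

open Classical in
/-- Permutations whose long cycles trace out `H` are pairs of an orientation of `H` and an
involution of the remaining vertices. -/
theorem sum_cycleSubgraph_eq [Fintype V] {H : G.Subgraph}
    (hH : ∀ v ∈ H.verts, (H.neighborSet v).ncard = 2) (w : V → V → ℤ[X]) :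
    ∑ π : Equiv.Perm V with G.IsEdgePerm π ∧ G.cycleSubgraph π = H,
        ((Equiv.Perm.sign π : ℤ) : ℤ[X]) * ∏ v, w v (π v) =
      (∑ ρ : Equiv.Perm {v // v ∈ H.verts} with H.coe.IsOrientation ρ,
        ((Equiv.Perm.sign ρ : ℤ) : ℤ[X]) * ∏ v : {v // v ∈ H.verts}, w v (ρ v)) *
      ∑ τ : Equiv.Perm {v // v ∉ H.verts} with (G.comap Subtype.val).IsMatchingPerm τ,
        ((Equiv.Perm.sign τ : ℤ) : ℤ[X]) * ∏ v : {v // v ∉ H.verts}, w v (τ v) := by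
  rw [Finset.sum_mul_sum, ← Finset.sum_product']
  symm
  refine Finset.sum_bij (fun x _ => x.1.subtypeCongr x.2) ?_ ?_ ?_ ?_
  · rintro ⟨ρ, τ⟩ hx
    obtain ⟨hρ, hτ⟩ := Finset.mem_product.1 hx
    replace hρ : H.coe.IsOrientation ρ := (Finset.mem_filter.1 hρ).2
    replace hτ : (G.comap Subtype.val).IsMatchingPerm τ := (Finset.mem_filter.1 hτ).2
    have hin : ∀ v : {v // v ∈ H.verts}, ρ.subtypeCongr τ v = ρ v :=
      Equiv.Perm.subtypeCongr.left_apply_subtype ρ τ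
    have hout : ∀ v : {v // v ∉ H.verts}, ρ.subtypeCongr τ v = τ v :=
      Equiv.Perm.subtypeCongr.right_apply_subtype ρ τ
    have hadj : ∀ v ∈ H.verts, H.Adj v (ρ.subtypeCongr τ v) := by
      intro v hv
      rw [hin ⟨v, hv⟩]
      exact (hρ ⟨v, hv⟩).1
    have hedge : G.IsEdgePerm (ρ.subtypeCongr τ) := by
      intro v hne
      by_cases hv : v ∈ H.verts
      · exact (hadj v hv).adj_sub
      · rw [hout ⟨v, hv⟩] at hne ⊢
        exact (hτ ⟨v, hv⟩).2 fun h => hne (congrArg Subtype.val h)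
    refine Finset.mem_filter.2 ⟨Finset.mem_univ _, hedge, (hedge.cycleSubgraph_eq_iff hH).2
      ⟨fun v => ?_, hadj⟩⟩
    by_cases hv : v ∈ H.verts
    · rw [hin ⟨v, hv⟩, hin]
      exact iff_of_true hv fun h => (hρ ⟨v, hv⟩).2 (Subtype.ext h)
    · rw [hout ⟨v, hv⟩, hout, (hτ ⟨v, hv⟩).1]
      simpa using hv
  · rintro ⟨ρ, τ⟩ - ⟨ρ', τ'⟩ - h
    exact Equiv.Perm.subtypeCongrHom_injective (· ∈ H.verts) h
  · intro π hπ
    obtain ⟨hedge, hπH⟩ := (Finset.mem_filter.1 hπ).2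
    obtain ⟨h1, h2⟩ := (hedge.cycleSubgraph_eq_iff hH).1 hπH
    -- `π` commutes with its square, so it preserves the set of vertices moved by the square and
    -- restricts to both blocks.
    have hmem : ∀ v, π v ∈ H.verts ↔ v ∈ H.verts := fun v => by
      rw [h1, h1, π.injective.ne_iff]
    have hmem' : ∀ v, π v ∉ H.verts ↔ v ∉ H.verts := fun v => not_congr (hmem v)
    refine ⟨(π.subtypePerm hmem, π.subtypePerm hmem'), Finset.mem_product.2
      ⟨Finset.mem_filter.2 ⟨Finset.mem_univ _, fun v => ⟨h2 v v.2, fun h => ?_⟩⟩,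
        Finset.mem_filter.2 ⟨Finset.mem_univ _, fun v => ⟨?_, fun h => ?_⟩⟩⟩, ?_⟩
    · exact (h1 v).1 v.2 (congrArg Subtype.val h)
    · exact Subtype.ext (not_not.1 ((not_congr (h1 v)).1 v.2))
    · exact hedge v fun h' => h (Subtype.ext h')
    · ext v
      by_cases hv : v ∈ H.verts
      · exact Equiv.Perm.subtypeCongr.left_apply _ _ hv
      · exact Equiv.Perm.subtypeCongr.right_apply _ _ hv
  · rintro ⟨ρ, τ⟩ -
    have hin : ∀ v : {v // v ∈ H.verts}, ρ.subtypeCongr τ v = ρ v :=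
      Equiv.Perm.subtypeCongr.left_apply_subtype ρ τ
    have hout : ∀ v : {v // v ∉ H.verts}, ρ.subtypeCongr τ v = τ v :=
      Equiv.Perm.subtypeCongr.right_apply_subtype ρ τ
    rw [Equiv.Perm.sign_subtypeCongr,
      ← Fintype.prod_subtype_mul_prod_subtype (· ∈ H.verts)
        (fun v => w v (ρ.subtypeCongr τ v))]
    simp_rw [hin, hout]
    push_cast
    ring

end SimpleGraph

/-! ### The expansion of the characteristic polynomial -/

namespace SignedGraph

variable {V : Type*} (Γ : SignedGraph V)

open Classical in
/-- The adjacency matrix with integer entries. -/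
noncomputable def intAdjMatrix : Matrix V V ℤ :=
  Matrix.of fun u v => if h : Γ.graph.Adj u v then (Γ.sign ⟨s(u, v), h⟩ : ℤ) else 0

variable {Γ}

theorem intAdjMatrix_apply_of_adj {u v : V} (h : Γ.graph.Adj u v) :
    Γ.intAdjMatrix u v = Γ.sign ⟨s(u, v), h⟩ := by
  simp [intAdjMatrix, h]

theorem intAdjMatrix_apply_of_not_adj {u v : V} (h : ¬ Γ.graph.Adj u v) :
    Γ.intAdjMatrix u v = 0 := by
  simp [intAdjMatrix, h]

theorem intAdjMatrix_symm (u v : V) : Γ.intAdjMatrix u v = Γ.intAdjMatrix v u := by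
  by_cases h : Γ.graph.Adj u v
  · rw [intAdjMatrix_apply_of_adj h, intAdjMatrix_apply_of_adj h.symm]
    congr 3
    exact Sym2.eq_swap
  · rw [intAdjMatrix_apply_of_not_adj h, intAdjMatrix_apply_of_not_adj fun h' => h h'.symm]

theorem intAdjMatrix_mul_self {u v : V} (h : Γ.graph.Adj u v) :
    Γ.intAdjMatrix u v * Γ.intAdjMatrix u v = 1 := by
  rw [intAdjMatrix_apply_of_adj h, ← Units.val_mul, Int.units_mul_self, Units.val_one]

theorem map_intAdjMatrix : Γ.intAdjMatrix.map (Int.castRingHom ℝ) = Γ.adjMatrix := by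
  ext u v
  by_cases h : Γ.graph.Adj u v <;> simp [intAdjMatrix, adjMatrix, h]

open Classical in
-- Every edge of `H` is `{v, ρ v}` for exactly one `v`; uniqueness is the absence of 2-cycles.
theorem prod_intAdjMatrix_orientation [Fintype V] {H : Γ.graph.Subgraph}
    (hH : ∀ v ∈ H.verts, (H.neighborSet v).ncard = 2) {ρ : Equiv.Perm {v // v ∈ H.verts}}
    (hρ : H.coe.IsOrientation ρ) :
    ∏ v : {v // v ∈ H.verts}, Γ.intAdjMatrix v (ρ v) = Γ.subgraphSign H := by
  have hK := SimpleGraph.Subgraph.ncard_neighborSet_coe hH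
  let F : {v // v ∈ H.verts} → H.edgeSet := fun v => ⟨s((v : V), (ρ v : V)), (hρ v).1⟩
  have hF : Function.Bijective F := by
    constructor
    · intro u v huv
      rcases Sym2.eq_iff.1 (congrArg Subtype.val huv) with ⟨h, -⟩ | ⟨h1, h2⟩
      · exact Subtype.ext h
      · exact absurd (by rw [← Subtype.ext h1, Subtype.ext h2]) (hρ v).2
    · rintro ⟨e, he⟩
      induction e using Sym2.ind with
      | _ u v =>
        have huv : H.Adj u v := he
        have hco : H.coe.Adj ⟨u, huv.fst_mem⟩ ⟨v, huv.snd_mem⟩ := huv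
        rcases (hρ.adj_iff hK).1 hco with h | h
        · exact ⟨⟨u, huv.fst_mem⟩, Subtype.ext (by simp only [F]; rw [← h])⟩
        · exact ⟨⟨v, huv.snd_mem⟩, Subtype.ext (by simp only [F]; rw [← h]; exact Sym2.eq_swap)⟩
  rw [subgraphSign, Units.coe_prod]
  refine Fintype.prod_bijective F hF _ _ fun v => ?_
  exact intAdjMatrix_apply_of_adj (hρ v).1.adj_sub

open Classical in
-- All orientations contribute equally. The factor `(-1) ^ |V(H)|` from the entries `-σ` cancels the
-- one in `sign ρ`, leaving `(-1) ^ p(H) * σ(H)`, and there are `2 ^ p(H)` orientations.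
theorem sum_isOrientation [Fintype V] {H : Γ.graph.Subgraph}
    (hH : ∀ v ∈ H.verts, (H.neighborSet v).ncard = 2) {w : V → V → ℤ[X]}
    (hw : ∀ u v, Γ.graph.Adj u v → w u v = -C (Γ.intAdjMatrix u v)) :
    ∑ ρ : Equiv.Perm {v // v ∈ H.verts} with H.coe.IsOrientation ρ,
        ((Equiv.Perm.sign ρ : ℤ) : ℤ[X]) * ∏ v : {v // v ∈ H.verts}, w v (ρ v) =
      C ((Γ.subgraphSign H : ℤ) * (-2) ^ Γ.numCycles H) := by
  have hK := SimpleGraph.Subgraph.ncard_neighborSet_coe hH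
  rw [Finset.sum_congr rfl (g := fun _ => C ((Γ.subgraphSign H : ℤ) * (-1) ^ Γ.numCycles H)),
    Finset.sum_const, nsmul_eq_mul]
  · have hcard := SimpleGraph.card_isOrientation hK
    rw [Nat.card_eq_fintype_card, Fintype.card_subtype] at hcard
    rw [hcard, numCycles, neg_pow (2 : ℤ)]
    simp only [map_mul, map_pow, map_neg, map_one, Nat.cast_pow, Nat.cast_ofNat, map_ofNat]
    ring
  · intro ρ hρ
    replace hρ : H.coe.IsOrientation ρ := (Finset.mem_filter.1 hρ).2
    have hprod : ∏ v : {v // v ∈ H.verts}, w v (ρ v) = C ((-1) ^ Fintype.card {v // v ∈ H.verts} *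
        (Γ.subgraphSign H : ℤ)) := by
      rw [← prod_intAdjMatrix_orientation hH hρ, Finset.prod_congr rfl fun v _ =>
        hw _ _ (hρ v).1.adj_sub, Finset.prod_neg]
      simp
    rw [hprod, hρ.sign_eq hK, numCycles, ← eq_intCast C, ← C_mul]
    congr 1
    push_cast
    have hone : (-1 : ℤ) ^ Fintype.card {v // v ∈ H.verts} *
        (-1) ^ Fintype.card {v // v ∈ H.verts} = 1 := by
      rw [← mul_pow]
      simp
    linear_combination
      ((Γ.subgraphSign H : ℤ) * (-1) ^ Nat.card H.coe.ConnectedComponent) * hone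

open Classical in
theorem sum_isMatchingPerm_compl [Fintype V] (H : Γ.graph.Subgraph) {w : V → V → ℤ[X]}
    (hX : ∀ v, w v v = X) (hw : ∀ u v, Γ.graph.Adj u v → w u v * w v u = 1) :
    ∑ τ : Equiv.Perm {v // v ∉ H.verts} with (Γ.graph.comap Subtype.val).IsMatchingPerm τ,
        ((Equiv.Perm.sign τ : ℤ) : ℤ[X]) * ∏ v : {v // v ∉ H.verts}, w v (τ v) =
      (Γ.graph.induce (H.vertsᶜ : Set V)).matchingPolynomial := by
  have hind : (Γ.graph.induce (H.vertsᶜ : Set V)).matchingPolynomial =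
      (Γ.graph.comap (Subtype.val : {v // v ∉ H.verts} → V)).matchingPolynomial := rfl
  rw [hind, ← SimpleGraph.sum_isMatchingPerm
    (Γ.graph.comap (Subtype.val : {v // v ∉ H.verts} → V))
    (w := fun u v => w u v) (fun v => hX v) (fun u v h => hw u v h)]
  congr!

open Classical in
/-- The Sachs-type expansion of the characteristic polynomial. -/
theorem charpoly_intAdjMatrix [Fintype V] :
    Γ.intAdjMatrix.charpoly =
      ∑ H : Γ.graph.Subgraph with ∀ v ∈ H.verts, (H.neighborSet v).ncard = 2,
        C ((Γ.subgraphSign H : ℤ) * (-2) ^ Γ.numCycles H) *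
          (Γ.graph.induce (H.vertsᶜ : Set V)).matchingPolynomial := by
  let w : V → V → ℤ[X] := Γ.intAdjMatrix.charmatrix
  have hX : ∀ v, w v v = X := fun v => by
    simp [w, intAdjMatrix_apply_of_not_adj (Γ.graph.loopless.irrefl v)]
  have hne : ∀ u v, u ≠ v → w u v = -C (Γ.intAdjMatrix u v) := fun u v h =>
    Matrix.charmatrix_apply_ne _ _ _ h
  have hww : ∀ u v, Γ.graph.Adj u v → w u v * w v u = 1 := fun u v h => by
    rw [hne _ _ h.ne, hne _ _ h.ne', intAdjMatrix_symm v u, neg_mul_neg, ← C_mul,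
      intAdjMatrix_mul_self h, C_1]
  have hzero : ∀ π : Equiv.Perm V, ¬ Γ.graph.IsEdgePerm π → ∏ v, w v (π v) = 0 := by
    intro π hπ
    simp only [SimpleGraph.IsEdgePerm, not_forall] at hπ
    obtain ⟨v, hv, hv'⟩ := hπ
    refine Finset.prod_eq_zero (Finset.mem_univ v) ?_
    rw [hne _ _ (Ne.symm hv), intAdjMatrix_apply_of_not_adj hv', C_0, neg_zero]
  -- Transposing makes the product run over the entries at `(v, π v)` instead of `(π v, v)`.
  rw [Matrix.charpoly, ← Matrix.det_transpose, Matrix.det_apply']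
  change ∑ π : Equiv.Perm V, ((Equiv.Perm.sign π : ℤ) : ℤ[X]) * ∏ v, w v (π v) = _
  rw [← Finset.sum_filter_of_ne (p := Γ.graph.IsEdgePerm) fun π _ h => by
      by_contra h'
      exact h (by rw [hzero π h', mul_zero]),
    ← Finset.sum_fiberwise_of_maps_to (g := Γ.graph.cycleSubgraph) (t := Finset.univ.filter
      fun H : Γ.graph.Subgraph => ∀ v ∈ H.verts, (H.neighborSet v).ncard = 2) fun π hπ =>
        Finset.mem_filter.2 ⟨Finset.mem_univ _, fun v hv =>
          (Finset.mem_filter.1 hπ).2.ncard_neighborSet hv⟩]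
  refine Finset.sum_congr rfl fun H hH => ?_
  replace hH := (Finset.mem_filter.1 hH).2
  rw [Finset.filter_filter, SimpleGraph.sum_cycleSubgraph_eq hH,
    sum_isOrientation hH fun u v h => hne u v h.ne,
    sum_isMatchingPerm_compl H hX hww]

end SignedGraph

/-! ### Parity under `x ↦ -x` and symmetry of the spectrum -/

/-- The substitution negates the roots. A split polynomial is determined by its roots and leading
coefficient, and the latter is `(-1) ^ natDegree` on both sides. -/
theorem Polynomial.Splits.comp_neg_X_eq_iff {p : ℝ[X]} (hp : p.Monic) (hs : p.Splits) :
    p.comp (-X) = (-1) ^ p.natDegree * p ↔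
      ∀ μ ∈ p.roots, -μ ∈ p.roots ∧ p.roots.count (-μ) = p.roots.count μ := by
  classical
  have hcount : ∀ μ, (p.comp (-X)).roots.count μ = p.roots.count (-μ) := by
    intro μ
    rw [roots_comp_neg_X, ← neg_neg μ, neg_neg (-μ)]
    exact Multiset.count_map_eq_count' _ _ neg_injective _
  have hC : ((-1 : ℝ[X]) ^ p.natDegree) = C ((-1) ^ p.natDegree) := by simp
  have hunit : ((-1 : ℝ) ^ p.natDegree) ≠ 0 := pow_ne_zero _ (by norm_num)
  constructor
  · intro h μ hμ
    have h1 : p.roots.count (-μ) = p.roots.count μ := by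
      rw [← hcount, h, hC, roots_C_mul _ hunit]
    exact ⟨Multiset.count_pos.1 (h1 ▸ Multiset.count_pos.2 hμ), h1⟩
  · intro h
    have hroots : (p.comp (-X)).roots = p.roots := by
      ext μ
      rw [hcount]
      by_cases hμ : μ ∈ p.roots
      · exact (h μ hμ).2
      · rw [Multiset.count_eq_zero_of_notMem hμ, Multiset.count_eq_zero]
        intro h'
        exact hμ (neg_neg μ ▸ (h _ h').1)
    have hs' : (p.comp (-X)).Splits := by
      rw [splits_iff_card_roots, hroots, splits_iff_card_roots.1 hs, natDegree_comp]
      simp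
    rw [hs'.eq_prod_roots, hroots, hC, comp_neg_X_leadingCoeff_eq, hp.leadingCoeff, mul_one,
      ← hs.eq_prod_roots_of_monic hp]

theorem SimpleGraph.matchingPolynomial_comp_neg_X {W : Type*} (K : SimpleGraph W) :
    K.matchingPolynomial.comp (-X) = (-1) ^ Nat.card W * K.matchingPolynomial := by
  rw [matchingPolynomial, Polynomial.sum_comp, Finset.mul_sum]
  refine Finset.sum_congr rfl fun i hi => ?_
  rw [Finset.mem_range] at hi
  -- The range bound gives `2 * i ≤ Nat.card W`, so the subtraction is not truncated and the
  -- exponent has the parity of `Nat.card W`.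
  have h : Nat.card W = (Nat.card W - 2 * i) + 2 * i := by omega
  have hpow : (-1 : ℤ[X]) ^ Nat.card W = (-1) ^ (Nat.card W - 2 * i) := by
    conv_lhs => rw [h, pow_add, pow_mul]
    simp
  rw [hpow, mul_comp, C_comp, X_pow_comp, neg_pow (X : ℤ[X])]
  ring

namespace SignedGraph

variable {V : Type*} (Γ : SignedGraph V)

open Classical in
/-- The even counterpart of `oddPart`, including the term of the empty subgraph. -/
noncomputable def evenPart [Fintype V] : ℤ[X] :=
  ∑ H : Γ.graph.Subgraph with
      (∀ v ∈ H.verts, (H.neighborSet v).ncard = 2) ∧ ¬ Odd H.verts.ncard,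
    C ((Γ.subgraphSign H : ℤ) * (-2) ^ Γ.numCycles H) *
      (Γ.graph.induce (H.vertsᶜ : Set V)).matchingPolynomial

variable {Γ}

open Classical in
theorem charpoly_intAdjMatrix_eq_add [Fintype V] :
    Γ.intAdjMatrix.charpoly = Γ.oddPart + Γ.evenPart := by
  rw [charpoly_intAdjMatrix, ← Finset.sum_filter_add_sum_filter_not _
    (fun H : Γ.graph.Subgraph => Odd H.verts.ncard), Finset.filter_filter, Finset.filter_filter,
    oddPart, evenPart]
  congr 1
  refine Finset.sum_congr (Finset.filter_congr fun H _ => ?_) fun _ _ => rfl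
  -- An odd vertex count already forces nonemptiness, so the empty subgraph falls into `evenPart`
  -- only.
  refine ⟨fun h => ⟨⟨Set.nonempty_of_ncard_ne_zero fun h0 => ?_, h.1⟩, h.2⟩,
    fun h => ⟨h.1.2, h.2⟩⟩
  simp [h0] at h

theorem matchingPolynomial_compl_comp_neg_X [Fintype V] (H : Γ.graph.Subgraph) :
    (Γ.graph.induce (H.vertsᶜ : Set V)).matchingPolynomial.comp (-X) =
      (-1) ^ Fintype.card V * (-1) ^ H.verts.ncard *
        (Γ.graph.induce (H.vertsᶜ : Set V)).matchingPolynomial := by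
  rw [SimpleGraph.matchingPolynomial_comp_neg_X, Nat.card_coe_set_eq, ← pow_add]
  have h := Set.ncard_add_ncard_compl H.verts
  rw [Nat.card_eq_fintype_card] at h
  rw [← h, add_right_comm, pow_add, ← two_mul, pow_mul]
  simp

theorem oddPart_comp_neg_X [Fintype V] :
    Γ.oddPart.comp (-X) = -((-1) ^ Fintype.card V * Γ.oddPart) := by
  classical
  rw [oddPart, Polynomial.sum_comp, Finset.mul_sum, ← Finset.sum_neg_distrib]
  refine Finset.sum_congr rfl fun H hH => ?_
  rw [mul_comp, C_comp, matchingPolynomial_compl_comp_neg_X,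
    (Finset.mem_filter.1 hH).2.2.neg_one_pow]
  ring

theorem evenPart_comp_neg_X [Fintype V] :
    Γ.evenPart.comp (-X) = (-1) ^ Fintype.card V * Γ.evenPart := by
  classical
  rw [evenPart, Polynomial.sum_comp, Finset.mul_sum]
  refine Finset.sum_congr rfl fun H hH => ?_
  rw [mul_comp, C_comp, matchingPolynomial_compl_comp_neg_X,
    (Nat.not_odd_iff_even.1 (Finset.mem_filter.1 hH).2.2).neg_one_pow]
  ring

theorem isHermitian_adjMatrix : Γ.adjMatrix.IsHermitian := by
  ext u v
  rw [← map_intAdjMatrix]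
  simp [intAdjMatrix_symm u v]

open Classical in
-- A real symmetric matrix has a split characteristic polynomial, so the root criterion applies; the
-- resulting identity descends to `ℤ[X]` by injectivity of the coefficient map.
theorem hasSymmetricSpectrum_iff [Fintype V] :
    Γ.HasSymmetricSpectrum ↔
      Γ.intAdjMatrix.charpoly.comp (-X) = (-1) ^ Fintype.card V * Γ.intAdjMatrix.charpoly := by
  have hmap : Γ.adjMatrix.charpoly = Γ.intAdjMatrix.charpoly.map (Int.castRingHom ℝ) := by
    rw [← Matrix.charpoly_map, map_intAdjMatrix]
  have h := Polynomial.Splits.comp_neg_X_eq_iff Γ.adjMatrix.charpoly_monic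
    Γ.isHermitian_adjMatrix.splits_charpoly
  rw [Matrix.charpoly_natDegree_eq_dim] at h
  refine h.symm.trans ?_
  rw [hmap, ← (map_injective (Int.castRingHom ℝ) Int.cast_injective).eq_iff]
  simp [Polynomial.map_comp]

end SignedGraph

theorem mainTheorem2 {V : Type*} [Fintype V] (Γ : SignedGraph V) :
    Γ.HasSymmetricSpectrum ↔ Γ.oddPart = 0 := by
  -- The even parts cancel, leaving `(-1) ^ n * oddPart` equal to its own negative, hence zero.
  rw [SignedGraph.hasSymmetricSpectrum_iff, SignedGraph.charpoly_intAdjMatrix_eq_add, add_comp,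
    SignedGraph.oddPart_comp_neg_X, SignedGraph.evenPart_comp_neg_X, mul_add, add_left_inj,
    neg_eq_self]
  exact mul_eq_zero_iff_left (pow_ne_zero _ (by simp))
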